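/- Let $q=2^{2m+1}$ with $m\ge 1$, let $\theta$ be the automorphism $x\mapsto x^{2^{m+1}}$ of $\mathbb{F}_q$, and let $G={\rm Sz}(q)$ be the Suzuki group, that is, the subgroup of ${\rm SL}_4(q)$ generated by the matrices $$\begin{pmatrix}1&0&0&0\\ a&1&0&0\\ b&\theta(a)&1&0\\ a^2\theta(a)+ab+\theta(b)&a\,\theta(a)+b&a&1\end{pmatrix}\quad(a,b\in\mathbb{F}_q),$$ the diagonal matrices ${\rm diag}(k\theta(k),k,k^{-1},(k\theta(k))^{-1})$ $(k\in\mathbb{F}_q^\times)$ and the antidiagonal permutation matrix. The enhanced power graph $\mathcal{E}(G)$ is the graph with vertex set $G$ in which two distinct elements $x,y$ are adjacent if and only if $\langle x,y\rangle$ is cyclic. A graph is a cograph if it has no induced subgraph isomorphic to the path on four vertices. A maximal cyclic subgroup of $G$ is a cyclic subgroup that is not properly contained in another cyclic subgroup of $G$. Then $\mathcal{E}(G)$ is a cograph, and the intersection of any two distinct maximal cyclic subgroups of $G$ has order at most $2$. -/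

import Mathlib

open scoped MatrixGroups

namespace Suzuki

/-- The graph on `G` in which distinct `x`, `y` are adjacent iff `⟨x, y⟩` is cyclic. -/
def enhancedPowerGraph (G : Type*) [Group G] : SimpleGraph G where
  Adj x y := x ≠ y ∧ IsCyclic (Subgroup.closure ({x, y} : Set G))
  symm := ⟨fun x y h => ⟨h.1.symm, by rw [Set.pair_comm]; exact h.2⟩⟩
  loopless := ⟨fun _ h => h.1 rfl⟩

/-- A cograph: no induced subgraph is a path on four vertices. -/
def IsCograph {V : Type*} (Γ : SimpleGraph V) : Prop :=
  ¬ (SimpleGraph.pathGraph 4).IsIndContained Γ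

/-- A cyclic subgroup that is not properly contained in another cyclic subgroup. -/
def IsMaximalCyclic {G : Type*} [Group G] (C : Subgroup G) : Prop :=
  Maximal (fun H : Subgroup G => IsCyclic H) C

section

variable {F : Type*} [Field F] (m : ℕ)

/-- The map `x ↦ x ^ (2 ^ (m + 1))`; on the field with `2 ^ (2 * m + 1)` elements it is the
automorphism `θ` with `θ (θ x) = x ^ 2`. -/
def theta (x : F) : F := x ^ (2 ^ (m + 1))

/-- The unitriangular matrices `S(a, b)`. -/
def unipotent (a b : F) : SL(4, F) :=
  ⟨!![1, 0, 0, 0;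
      a, 1, 0, 0;
      b, theta m a, 1, 0;
      a ^ 2 * theta m a + a * b + theta m b, a * theta m a + b, a, 1], by
    simp [Matrix.det_succ_row_zero, Fin.sum_univ_succ, Fin.succAbove]⟩

/-- The diagonal matrices `diag(k θ(k), k, k⁻¹, (k θ(k))⁻¹)`, `k ≠ 0`. -/
def torus (k : Fˣ) : SL(4, F) :=
  ⟨Matrix.diagonal ![(k : F) * theta m (k : F), k, (k : F)⁻¹, ((k : F) * theta m (k : F))⁻¹], by
    have h : (k : F) ≠ 0 := k.ne_zero
    have h' : theta m (k : F) ≠ 0 := pow_ne_zero _ h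
    simp [Matrix.det_diagonal, Fin.prod_univ_four]
    field_simp⟩

end

/-- The antidiagonal permutation matrix. -/
def weyl {F : Type*} [Field F] : SL(4, F) :=
  ⟨!![0, 0, 0, 1;
      0, 0, 1, 0;
      0, 1, 0, 0;
      1, 0, 0, 0], by
    simp [Matrix.det_succ_row_zero, Fin.sum_univ_succ, Fin.succAbove]
    norm_num⟩

/-- The Suzuki group `Sz(q)`, for a field `F` with `q = 2 ^ (2 * m + 1)` elements: the subgroup of
`SL(4, q)` generated by all `S(a, b)`, the diagonal matrices above and the antidiagonal
permutation matrix. -/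
def Sz (F : Type*) [Field F] (m : ℕ) : Subgroup SL(4, F) :=
  Subgroup.closure
    (Set.range (fun p : F × F => unipotent m p.1 p.2) ∪ Set.range (torus (F := F) m) ∪ {weyl})

end Suzuki

namespace Suzuki

/-! Everything follows from one property: if `z ^ 2 ≠ 1`, all cyclic subgroups containing `z` lie in
a common cyclic subgroup (`hasCyclicHull_of_sq_ne_one`). Neighbours of such a `z` are then pairwise
adjacent, so the inner vertices of an induced 4-path are involutions (the identity is adjacent to
everything); being adjacent, they lie in one cyclic group and coincide. Likewise a generator of the
intersection of two distinct maximal cyclic subgroups has square 1. Involutions must be excluded: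
`S(a, b)` squares to `S(0, a θ(a))` whatever `b` is.

The hull comes from the action on the Suzuki–Tits ovoid of `q ^ 2 + 1` points. By the Bruhat
decomposition, a nontrivial `z` with a fixed point is conjugate into the unipotent group or the
split torus. Its hull is then, up to conjugation, `⟨z⟩` or the torus.

If `z` fixes no point, `⟨z⟩` acts freely, so its order divides `q ^ 2 + 1`. This number is coprime
to `|GL_n(q)|` for `n ≤ 3`, which makes `z` irreducible on `F ^ 4`; by Schur and Wedderburn its
centralizer is cyclic, and it serves as the hull. -/

theorem finite_of_card (m : ℕ) {F : Type*} [hF : Fact (Nat.card F = 2 ^ (2 * m + 1))] :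
    Finite F :=
  Nat.finite_of_card_ne_zero (by rw [hF.out]; positivity)

theorem charP_two (m : ℕ) {F : Type*} [Field F] [hF : Fact (Nat.card F = 2 ^ (2 * m + 1))] :
    CharP F 2 := by
  have := finite_of_card m (F := F)
  have := Fintype.ofFinite F
  have : Fact (Nat.Prime 2) := ⟨Nat.prime_two⟩
  have h := hF.out
  rw [Nat.card_eq_fintype_card] at h
  exact charP_of_card_eq_prime_pow h

theorem eq_one_of_sq_eq_one (m : ℕ) {F : Type*} [Field F] [Fact (Nat.card F = 2 ^ (2 * m + 1))]
    {x : F} (h : x ^ 2 = 1) : x = 1 := by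
  have := charP_two m (F := F)
  have : (x + 1) ^ 2 = 0 := by rw [CharTwo.add_sq, h, one_pow, CharTwo.add_self_eq_zero]
  exact CharTwo.add_eq_zero.mp (pow_eq_zero_iff two_ne_zero |>.mp this)

/-! ### The automorphism `θ` and the Tits form -/

section FieldFacts

variable {F : Type*} [Field F] (m : ℕ)

theorem theta_mul (x y : F) : theta m (x * y) = theta m x * theta m y := mul_pow _ _ _

theorem theta_one : theta m (1 : F) = 1 := one_pow _

theorem theta_zero : theta m (0 : F) = 0 := zero_pow (by positivity)

theorem theta_div (x y : F) : theta m (x / y) = theta m x / theta m y := div_pow _ _ _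

theorem theta_inv (x : F) : theta m x⁻¹ = (theta m x)⁻¹ := inv_pow _ _

theorem theta_eq_zero {x : F} : theta m x = 0 ↔ x = 0 :=
  pow_eq_zero_iff (by positivity)

/-- The last coordinate `a² θ(a) + a b + θ(b)` of the affine points of the Suzuki–Tits ovoid. -/
def tits (a b : F) : F := a ^ 2 * theta m a + a * b + theta m b

variable [hF : Fact (Nat.card F = 2 ^ (2 * m + 1))]

theorem theta_add (x y : F) : theta m (x + y) = theta m x + theta m y := by
  have := charP_two m (F := F)
  exact add_pow_char_pow x y 2 (m + 1)

theorem theta_theta (x : F) : theta m (theta m x) = x ^ 2 := by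
  have := finite_of_card m (F := F)
  have := Fintype.ofFinite F
  have h := FiniteField.pow_card x
  rw [← Nat.card_eq_fintype_card, hF.out] at h
  unfold theta
  rw [← pow_mul]
  conv_rhs => rw [← h]
  rw [← pow_mul]
  congr 1
  ring

theorem theta_tits (a b : F) :
    theta m (tits m a b) = a ^ 2 * theta m a ^ 2 + theta m a * theta m b + b ^ 2 := by
  simp only [tits, theta_add, theta_mul, theta_theta, pow_two]
  ring

/-- Scaling `b = a θ(a) t` turns the equation into `1 + t + θ(t) = 0`. Applying `θ` and subtracting
gives `t ^ 2 = t`, but neither 0 nor 1 is a solution. -/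
theorem eq_zero_of_tits_eq_zero {a b : F} (h : tits m a b = 0) : a = 0 ∧ b = 0 := by
  have := charP_two m (F := F)
  by_cases ha : a = 0
  · subst ha
    simpa [tits, theta_zero, theta_eq_zero] using h
  · exfalso
    have hA : theta m a ≠ 0 := (theta_eq_zero m).not.mpr ha
    obtain ⟨t, rfl⟩ : ∃ t, b = a * theta m a * t := ⟨b / (a * theta m a), by field_simp⟩
    have h1 : 1 + t + theta m t = 0 := by
      have : a ^ 2 * theta m a * (1 + t + theta m t) = 0 := by
        rw [← h]
        simp only [tits, theta_mul, theta_theta]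
        ring
      exact (mul_eq_zero.mp this).resolve_left (mul_ne_zero (pow_ne_zero _ ha) hA)
    have h2 : 1 + theta m t + t ^ 2 = 0 := by
      have := congrArg (theta m) h1
      simpa only [theta_add, theta_one, theta_theta, theta_zero] using this
    have h3 : t * (t - 1) = 0 := by linear_combination h2 - h1
    rcases mul_eq_zero.mp h3 with h3 | h3
    · subst h3
      simp [theta_zero] at h1
    · rw [sub_eq_zero] at h3
      subst h3
      rw [theta_one, CharTwo.add_self_eq_zero] at h1
      simp at h1

theorem tits_ne_zero {a b : F} (h : ¬(a = 0 ∧ b = 0)) : tits m a b ≠ 0 :=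
  fun h' => h (eq_zero_of_tits_eq_zero m h')

theorem eq_one_of_theta_eq_one {k : F} (h : theta m k = 1) : k = 1 := by
  apply eq_one_of_sq_eq_one m
  rw [← theta_theta m, h, theta_one]

theorem eq_one_of_sq_mul_theta_eq_one {k : F} (h : k ^ 2 * theta m k = 1) : k = 1 := by
  have h1 := congrArg (theta m) h
  rw [theta_mul, theta_one, theta_theta, pow_two, theta_mul] at h1
  apply eq_one_of_theta_eq_one m
  linear_combination h1 - theta m k * h

end FieldFacts

/-! ### Relations between the generators -/

section Matrices

variable {F : Type*} [Field F] (m : ℕ)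

theorem coe_unipotent (a b : F) : (unipotent m a b : Matrix (Fin 4) (Fin 4) F) =
    !![1, 0, 0, 0;
      a, 1, 0, 0;
      b, theta m a, 1, 0;
      tits m a b, a * theta m a + b, a, 1] := rfl

theorem coe_torus (k : Fˣ) : (torus m k : Matrix (Fin 4) (Fin 4) F) =
    !![(k : F) * theta m (k : F), 0, 0, 0;
      0, (k : F), 0, 0;
      0, 0, (k : F)⁻¹, 0;
      0, 0, 0, ((k : F) * theta m (k : F))⁻¹] := by
  ext i j
  fin_cases i <;> fin_cases j <;> simp [torus]

theorem coe_weyl : ((weyl : SL(4, F)) : Matrix (Fin 4) (Fin 4) F) =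
    !![0, 0, 0, 1;
      0, 0, 1, 0;
      0, 1, 0, 0;
      1, 0, 0, 0] := rfl

theorem weyl_mul_weyl : (weyl : SL(4, F)) * weyl = 1 := by
  ext i j
  rw [Matrix.SpecialLinearGroup.coe_mul, coe_weyl]
  fin_cases i <;> fin_cases j <;> simp [Matrix.mul_apply, Fin.sum_univ_four]

theorem unipotent_zero : unipotent m (0 : F) 0 = 1 := by
  ext i j
  fin_cases i <;> fin_cases j <;> simp [unipotent, theta_zero]

theorem torus_mul (k l : Fˣ) : torus m (k * l) = torus m k * torus m l := by
  ext i j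
  rw [Matrix.SpecialLinearGroup.coe_mul, coe_torus, coe_torus, coe_torus, Units.val_mul, theta_mul]
  fin_cases i <;> fin_cases j <;> simp [Matrix.mul_apply, Fin.sum_univ_four] <;> ring

/-- The diagonal matrices `diag(k θ(k), k, k⁻¹, (k θ(k))⁻¹)` as the values of a homomorphism. -/
def torusHom : Fˣ →* SL(4, F) where
  toFun := torus m
  map_one' := by
    ext i j
    fin_cases i <;> fin_cases j <;> simp [torus, theta_one]
  map_mul' := torus_mul m

theorem torus_injective : Function.Injective (torus (F := F) m) := by
  intro k l h
  have := congrArg (fun g : SL(4, F) => (g : Matrix (Fin 4) (Fin 4) F) 1 1) h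
  simpa [torus, Units.ext_iff] using this

theorem weyl_mul_torus (k : Fˣ) : weyl * torus m k = torus m k⁻¹ * weyl := by
  ext i j
  simp only [Matrix.SpecialLinearGroup.coe_mul, coe_torus, coe_weyl, Units.val_inv_eq_inv_val,
    theta_inv]
  fin_cases i <;> fin_cases j <;> simp [Matrix.mul_apply, Fin.sum_univ_four, mul_comm]

variable [hF : Fact (Nat.card F = 2 ^ (2 * m + 1))]

theorem unipotent_mul (a b c d : F) :
    unipotent m a b * unipotent m c d = unipotent m (a + c) (b + d + theta m a * c) := by
  have := charP_two m (F := F)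
  ext i j
  simp only [Matrix.SpecialLinearGroup.coe_mul, coe_unipotent, tits, theta_mul, theta_add,
    theta_theta]
  fin_cases i <;> fin_cases j <;> simp [Matrix.mul_apply, Fin.sum_univ_four] <;>
    ring_nf <;> reduce_mod_char!

theorem torus_mul_unipotent (k : Fˣ) (a b : F) :
    torus m k * unipotent m a b =
      unipotent m (a / theta m (k : F)) (b / (k ^ 2 * theta m (k : F))) * torus m k := by
  have hk : (k : F) ≠ 0 := k.ne_zero
  have hk' : theta m (k : F) ≠ 0 := (theta_eq_zero m).not.mpr hk
  ext i j
  simp only [Matrix.SpecialLinearGroup.coe_mul, coe_unipotent, coe_torus, tits, theta_mul,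
    theta_div, theta_theta, pow_two]
  fin_cases i <;> fin_cases j <;> simp [Matrix.mul_apply, Fin.sum_univ_four] <;> field_simp

/-- `weyl` reverses `(1, a, b, f)` to `(f, b, a, 1)`; the identity says that the rescaled vector is
again on the ovoid. -/
theorem tits_weyl (a b : F) (h : tits m a b ≠ 0) :
    tits m (b / tits m a b) (a / tits m a b) = 1 / tits m a b := by
  have := charP_two m (F := F)
  have h' : theta m (tits m a b) ≠ 0 := (theta_eq_zero m).not.mpr h
  conv_lhs => rw [tits]
  rw [theta_div, theta_div]
  field_simp
  rw [theta_tits, tits]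
  ring_nf
  reduce_mod_char!

/-- The rank-one relation behind the Bruhat decomposition. The unipotent factors are forced by the
action on the ovoid: `weyl * S(a, b) * weyl` sends infinity to the point with the coordinates of the
right-hand factor, and sends to infinity the point with those of the left-hand factor. Both sides
then agree on infinity and the origin, which leaves only a torus element. -/
theorem weyl_unipotent_weyl (a b : F) (h : ¬(a = 0 ∧ b = 0)) (k : Fˣ)
    (hk : (k : F) = tits m a b / theta m (tits m a b)) :
    weyl * unipotent m a b * weyl *
        unipotent m ((b + a * theta m a) / tits m a b) (a / tits m a b) =
      unipotent m (b / tits m a b) (a / tits m a b) * weyl * torus m k := by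
  have := charP_two m (F := F)
  have hf := tits_ne_zero m h
  have hf' : theta m (tits m a b) ≠ 0 := (theta_eq_zero m).not.mpr hf
  have e1 := tits_weyl m a b hf
  have e2 : tits m ((b + a * theta m a) / tits m a b) (a / tits m a b) = 1 / tits m a b := by
    have : tits m a b = tits m a (b + a * theta m a) := by
      simp only [tits, theta_add, theta_mul, theta_theta]
      linear_combination (- a ^ 2 * theta m a) * (CharTwo.two_eq_zero (R := F))
    rw [this]
    exact tits_weyl m _ _ (this ▸ hf)
  have et := theta_tits m a b
  ext i j
  simp only [Matrix.SpecialLinearGroup.coe_mul, coe_unipotent, coe_torus, coe_weyl, e1, e2, hk,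
    theta_add, theta_mul, theta_div, theta_theta]
  generalize theta m (tits m a b) = y at *
  have ef : tits m a b = a ^ 2 * theta m a + a * b + theta m b := rfl
  generalize tits m a b = x at *
  fin_cases i <;> fin_cases j <;> simp [Matrix.mul_apply, Fin.sum_univ_four] <;>
    field_simp <;> (try rw [et]) <;> (try rw [ef]) <;> ring_nf <;> reduce_mod_char!

end Matrices

/-! ### The action on the Suzuki–Tits ovoid and the Bruhat decomposition -/

section Action

open Matrix

/-- The points of the Suzuki–Tits ovoid: the point at infinity and the affine points. -/
inductive Ovoid (F : Type*)
  | infty : Ovoid F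
  | affine (a b : F) : Ovoid F

/-- The ovoid has one point more than the affine plane. -/
def Ovoid.equivOption (F : Type*) : Ovoid F ≃ Option (F × F) where
  toFun
    | infty => none
    | affine a b => some (a, b)
  invFun
    | none => infty
    | some p => affine p.1 p.2
  left_inv ω := by cases ω <;> rfl
  right_inv p := by cases p <;> rfl

variable {F : Type*} [Field F] (m : ℕ)

/-- A vector spanning the line that is a given point of the ovoid. -/
def Ovoid.vec : Ovoid F → Fin 4 → F
  | .infty => ![0, 0, 0, 1]
  | .affine a b => ![1, a, b, tits m a b]

theorem Ovoid.eq_of_smul_vec_eq {ω ω' : Ovoid F} {c c' : F} (hc : c ≠ 0)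
    (h : c • ω.vec m = c' • ω'.vec m) : ω = ω' := by
  have h0 := congrFun h 0
  have h1 := congrFun h 1
  have h2 := congrFun h 2
  have h3 := congrFun h 3
  rcases ω with _ | ⟨a, b⟩ <;> rcases ω' with _ | ⟨a', b'⟩ <;>
    simp [Ovoid.vec] at h0 h1 h2 h3
  · rfl
  · rw [← h0, zero_mul] at h3
    exact absurd h3 hc
  · exact absurd h0 hc
  · subst h0
    obtain rfl := mul_left_cancel₀ hc h1
    obtain rfl := mul_left_cancel₀ hc h2
    rfl

theorem unipotent_mulVec_infty (a b : F) :
    (unipotent m a b : Matrix (Fin 4) (Fin 4) F) *ᵥ Ovoid.vec m .infty = Ovoid.vec m .infty := by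
  ext i
  fin_cases i <;> simp [coe_unipotent, Ovoid.vec, Matrix.mulVec, dotProduct, Fin.sum_univ_four]

theorem torus_mulVec_infty (k : Fˣ) :
    (torus m k : Matrix (Fin 4) (Fin 4) F) *ᵥ Ovoid.vec m .infty =
      ((k : F) * theta m (k : F))⁻¹ • Ovoid.vec m .infty := by
  ext i
  fin_cases i <;> simp [coe_torus, Ovoid.vec, Matrix.mulVec, dotProduct, Fin.sum_univ_four]

theorem vec_affine (a b : F) :
    Ovoid.vec m (.affine a b) =
      (unipotent m a b : Matrix (Fin 4) (Fin 4) F) *ᵥ ![1, 0, 0, 0] := by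
  ext i
  fin_cases i <;> simp [coe_unipotent, Ovoid.vec, Matrix.mulVec, dotProduct, Fin.sum_univ_four]

theorem weyl_mulVec (x y z t : F) :
    ((weyl : SL(4, F)) : Matrix (Fin 4) (Fin 4) F) *ᵥ ![x, y, z, t] = ![t, z, y, x] := by
  ext i
  fin_cases i <;> simp [coe_weyl, Matrix.mulVec, dotProduct, Fin.sum_univ_four]

/-- The matrix `g` maps the point `ω` to the point `ω'`. -/
def MapsPoint (g : SL(4, F)) (ω ω' : Ovoid F) : Prop :=
  ∃ c : F, c ≠ 0 ∧ (g : Matrix (Fin 4) (Fin 4) F) *ᵥ ω.vec m = c • ω'.vec m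

variable {m}

theorem MapsPoint.unique {g : SL(4, F)} {ω ω₁ ω₂ : Ovoid F} (h₁ : MapsPoint m g ω ω₁)
    (h₂ : MapsPoint m g ω ω₂) : ω₁ = ω₂ := by
  obtain ⟨c, hc, h⟩ := h₁
  obtain ⟨c', _, h'⟩ := h₂
  exact Ovoid.eq_of_smul_vec_eq m hc (h.symm.trans h')

theorem MapsPoint.mul {g h : SL(4, F)} {ω ω₁ ω₂ : Ovoid F} (hg : MapsPoint m g ω₁ ω₂)
    (hh : MapsPoint m h ω ω₁) : MapsPoint m (g * h) ω ω₂ := by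
  obtain ⟨c, hc, e⟩ := hg
  obtain ⟨d, hd, e'⟩ := hh
  refine ⟨d * c, mul_ne_zero hd hc, ?_⟩
  rw [Matrix.SpecialLinearGroup.coe_mul, ← Matrix.mulVec_mulVec, e', Matrix.mulVec_smul, e,
    smul_smul]

theorem MapsPoint.one (ω : Ovoid F) : MapsPoint m 1 ω ω :=
  ⟨1, one_ne_zero, by simp⟩

theorem MapsPoint.unipotent_infty (a b : F) : MapsPoint m (unipotent m a b) .infty .infty :=
  ⟨1, one_ne_zero, by rw [unipotent_mulVec_infty, one_smul]⟩

theorem MapsPoint.torus_infty (k : Fˣ) : MapsPoint m (torus m k) .infty .infty :=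
  ⟨_, inv_ne_zero (mul_ne_zero k.ne_zero ((theta_eq_zero m).not.mpr k.ne_zero)),
    torus_mulVec_infty m k⟩

theorem MapsPoint.weyl_infty : MapsPoint m (weyl : SL(4, F)) .infty (.affine 0 0) :=
  ⟨1, one_ne_zero, by simp [Ovoid.vec, weyl_mulVec, tits, theta_zero]⟩

theorem MapsPoint.weyl_zero : MapsPoint m (weyl : SL(4, F)) (.affine 0 0) .infty :=
  ⟨1, one_ne_zero, by simp [Ovoid.vec, weyl_mulVec, tits, theta_zero]⟩

theorem unipotent_mem (a b : F) : unipotent m a b ∈ Sz F m :=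
  Subgroup.subset_closure (Or.inl (Or.inl ⟨(a, b), rfl⟩))

theorem torus_mem (k : Fˣ) : torus m k ∈ Sz F m :=
  Subgroup.subset_closure (Or.inl (Or.inr ⟨k, rfl⟩))

theorem weyl_mem : weyl ∈ Sz F m :=
  Subgroup.subset_closure (Or.inr rfl)

variable (m)

/-- `S(a, b)` as an element of the Suzuki group. -/
def unip (a b : F) : Sz F m := ⟨unipotent m a b, unipotent_mem a b⟩

/-- The split torus of the Suzuki group. -/
def tor : Fˣ →* Sz F m := (torusHom m).codRestrict _ torus_mem

/-- The antidiagonal permutation matrix as an element of the Suzuki group. -/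
def weylElt : Sz F m := ⟨weyl, weyl_mem⟩

theorem unip_zero : unip m (0 : F) 0 = 1 := Subtype.ext (unipotent_zero m)

theorem weylElt_mul_tor (k : Fˣ) : weylElt m * tor m k = tor m k⁻¹ * weylElt m :=
  Subtype.ext (weyl_mul_torus m k)

theorem tor_injective : Function.Injective (tor (F := F) m) :=
  fun _ _ h => torus_injective m (congrArg Subtype.val h)

variable {m}

variable [hF : Fact (Nat.card F = 2 ^ (2 * m + 1))]

theorem MapsPoint.unipotent_affine (a b c d : F) :
    MapsPoint m (unipotent m a b) (.affine c d) (.affine (a + c) (b + d + theta m a * c)) :=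
  ⟨1, one_ne_zero, by
    rw [one_smul, vec_affine, vec_affine, Matrix.mulVec_mulVec,
      ← Matrix.SpecialLinearGroup.coe_mul, unipotent_mul]⟩

theorem MapsPoint.torus_affine (k : Fˣ) (a b : F) :
    MapsPoint m (torus m k) (.affine a b)
      (.affine (a / theta m (k : F)) (b / (k ^ 2 * theta m (k : F)))) := by
  refine ⟨k * theta m (k : F), mul_ne_zero k.ne_zero ((theta_eq_zero m).not.mpr k.ne_zero), ?_⟩
  rw [vec_affine, vec_affine, Matrix.mulVec_mulVec, ← Matrix.SpecialLinearGroup.coe_mul,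
    torus_mul_unipotent, Matrix.SpecialLinearGroup.coe_mul, ← Matrix.mulVec_mulVec,
    ← Matrix.mulVec_smul]
  congr 1
  ext i
  fin_cases i <;> simp [coe_torus, Matrix.mulVec, dotProduct, Fin.sum_univ_four]

theorem MapsPoint.weyl_affine {a b : F} (h : ¬(a = 0 ∧ b = 0)) :
    MapsPoint m weyl (.affine a b) (.affine (b / tits m a b) (a / tits m a b)) := by
  have hf := tits_ne_zero m h
  refine ⟨tits m a b, hf, ?_⟩
  simp only [Ovoid.vec, weyl_mulVec, tits_weyl m a b hf]
  ext i
  fin_cases i <;> simp <;> field_simp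

/-- In a finite group the generators generate already as a monoid, so no step for inverses is
needed. -/
theorem Sz_induction {P : SL(4, F) → Prop} (one : P 1)
    (unip : ∀ a b g, P g → P (unipotent m a b * g)) (tor : ∀ k g, P g → P (torus m k * g))
    (weyl_mul : ∀ g, P g → P (weyl * g)) {g : SL(4, F)} (hg : g ∈ Sz F m) : P g := by
  have := finite_of_card m (F := F)
  have : Finite SL(4, F) := Subtype.finite
  rw [Sz, ← Subgroup.mem_toSubmonoid, Subgroup.closure_toSubmonoid_of_finite] at hg
  induction hg using Submonoid.closure_induction_left with
  | one => exact one
  | mul_left x hx y _ ih =>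
    rcases hx with (⟨⟨a, b⟩, rfl⟩ | ⟨k, rfl⟩) | rfl
    · exact unip a b y ih
    · exact tor k y ih
    · exact weyl_mul y ih

theorem exists_mapsPoint {g : SL(4, F)} (hg : g ∈ Sz F m) : ∀ ω, ∃ ω', MapsPoint m g ω ω' := by
  refine Sz_induction (P := fun g => ∀ ω, ∃ ω', MapsPoint m g ω ω')
    (fun ω => ⟨ω, .one ω⟩) ?_ ?_ ?_ hg
  · intro a b g ih ω
    obtain ⟨ω', h⟩ := ih ω
    rcases ω' with _ | ⟨c, d⟩
    · exact ⟨_, (MapsPoint.unipotent_infty a b).mul h⟩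
    · exact ⟨_, (MapsPoint.unipotent_affine a b c d).mul h⟩
  · intro k g ih ω
    obtain ⟨ω', h⟩ := ih ω
    rcases ω' with _ | ⟨c, d⟩
    · exact ⟨_, (MapsPoint.torus_infty k).mul h⟩
    · exact ⟨_, (MapsPoint.torus_affine k c d).mul h⟩
  · intro g ih ω
    obtain ⟨ω', h⟩ := ih ω
    rcases ω' with _ | ⟨c, d⟩
    · exact ⟨_, MapsPoint.weyl_infty.mul h⟩
    · by_cases h0 : c = 0 ∧ d = 0
      · obtain ⟨rfl, rfl⟩ := h0
        exact ⟨_, MapsPoint.weyl_zero.mul h⟩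
      · exact ⟨_, (MapsPoint.weyl_affine h0).mul h⟩

/-- The action of the Suzuki group on the ovoid. -/
noncomputable instance : MulAction (Sz F m) (Ovoid F) where
  smul g ω := (exists_mapsPoint g.2 ω).choose
  one_smul ω := (exists_mapsPoint (one_mem _) ω).choose_spec.unique (.one ω)
  mul_smul g h ω := (exists_mapsPoint (mul_mem g.2 h.2) ω).choose_spec.unique
    ((exists_mapsPoint g.2 _).choose_spec.mul (exists_mapsPoint h.2 ω).choose_spec)

theorem smul_eq_of_mapsPoint {g : Sz F m} {ω ω' : Ovoid F} (h : MapsPoint m g ω ω') :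
    g • ω = ω' :=
  (exists_mapsPoint g.2 ω).choose_spec.unique h

variable (m)

theorem unip_smul_infty (a b : F) : unip m a b • (.infty : Ovoid F) = .infty :=
  smul_eq_of_mapsPoint (MapsPoint.unipotent_infty (m := m) a b)

theorem unip_smul_affine (a b c d : F) :
    unip m a b • (.affine c d : Ovoid F) = .affine (a + c) (b + d + theta m a * c) :=
  smul_eq_of_mapsPoint (.unipotent_affine a b c d)

theorem tor_smul_infty (k : Fˣ) : tor m k • (.infty : Ovoid F) = .infty :=
  smul_eq_of_mapsPoint (.torus_infty k)

theorem tor_smul_affine (k : Fˣ) (a b : F) :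
    tor m k • (.affine a b : Ovoid F) =
      .affine (a / theta m (k : F)) (b / (k ^ 2 * theta m (k : F))) :=
  smul_eq_of_mapsPoint (.torus_affine k a b)

theorem weylElt_smul_infty : (weylElt m : Sz F m) • (.infty : Ovoid F) = .affine 0 0 :=
  smul_eq_of_mapsPoint .weyl_infty

theorem weylElt_smul_zero : (weylElt m : Sz F m) • (.affine 0 0 : Ovoid F) = .infty :=
  smul_eq_of_mapsPoint .weyl_zero

theorem unip_mul (a b c d : F) :
    unip m a b * unip m c d = unip m (a + c) (b + d + theta m a * c) :=
  Subtype.ext (unipotent_mul m a b c d)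

theorem weylElt_unip_weylElt {a b : F} (h : ¬(a = 0 ∧ b = 0)) :
    ∃ (k : Fˣ) (c d c' d' : F),
      weylElt m * unip m a b * weylElt m * unip m c d = unip m c' d' * weylElt m * tor m k := by
  have hf := tits_ne_zero m h
  have hf' : theta m (tits m a b) ≠ 0 := (theta_eq_zero m).not.mpr hf
  exact ⟨Units.mk0 _ (div_ne_zero hf hf'), _, _, _, _,
    Subtype.ext (weyl_unipotent_weyl m a b h _ rfl)⟩

theorem inv_unip (a b : F) : (unip m a b)⁻¹ = unip m a (b + a * theta m a) := by
  have := charP_two m (F := F)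
  rw [inv_eq_iff_mul_eq_one, unip_mul, ← unip_zero]
  congr 1
  · exact CharTwo.add_self_eq_zero a
  · rw [← add_assoc, CharTwo.add_self_eq_zero, zero_add, mul_comm, CharTwo.add_self_eq_zero]

/-- The Bruhat decomposition. -/
theorem bruhat (g : Sz F m) :
    (∃ a b k, g = unip m a b * tor m k) ∨
      ∃ a b c d k, g = unip m a b * weylElt m * unip m c d * tor m k := by
  suffices ∀ g ∈ Sz F m, (∃ a b k, g = unipotent m a b * torus m k) ∨
      ∃ a b c d k, g = unipotent m a b * weyl * unipotent m c d * torus m k by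
    rcases this g g.2 with ⟨a, b, k, h⟩ | ⟨a, b, c, d, k, h⟩
    · exact Or.inl ⟨a, b, k, Subtype.ext h⟩
    · exact Or.inr ⟨a, b, c, d, k, Subtype.ext h⟩
  intro g hg
  refine Sz_induction (P := fun g => (∃ a b k, g = unipotent m a b * torus m k) ∨
    ∃ a b c d k, g = unipotent m a b * weyl * unipotent m c d * torus m k) ?_ ?_ ?_ ?_ hg
  · exact Or.inl ⟨0, 0, 1, by rw [unipotent_zero, one_mul]; exact (map_one (torusHom m)).symm⟩
  · rintro a b g (⟨a', b', k, rfl⟩ | ⟨a', b', c, d, k, rfl⟩)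
    · exact Or.inl ⟨_, _, k, by rw [← mul_assoc, unipotent_mul]⟩
    · exact Or.inr ⟨_, _, c, d, k, by
        rw [← mul_assoc, ← mul_assoc, ← mul_assoc, unipotent_mul]⟩
  · rintro l g (⟨a, b, k, rfl⟩ | ⟨a, b, c, d, k, rfl⟩)
    · exact Or.inl ⟨_, _, l * k, by rw [← mul_assoc, torus_mul_unipotent, mul_assoc, torus_mul]⟩
    · refine Or.inr ⟨a / theta m (l : F), b / (l ^ 2 * theta m (l : F)),
        c / theta m ((l⁻¹ : Fˣ) : F), d / ((l⁻¹ : Fˣ) ^ 2 * theta m ((l⁻¹ : Fˣ) : F)),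
        l⁻¹ * k, ?_⟩
      have e : torus m l * weyl = weyl * torus m l⁻¹ := by rw [weyl_mul_torus, inv_inv]
      rw [← mul_assoc, ← mul_assoc, ← mul_assoc, torus_mul_unipotent, mul_assoc _ (torus m l), e,
        ← mul_assoc, mul_assoc _ (torus m l⁻¹), torus_mul_unipotent, torus_mul]
      simp only [mul_assoc]
  · rintro g (⟨a, b, k, rfl⟩ | ⟨a, b, c, d, k, rfl⟩)
    · exact Or.inr ⟨0, 0, a, b, k, by rw [unipotent_zero, one_mul, mul_assoc]⟩
    -- If the middle factor is trivial the two copies of `weyl` cancel; otherwise the rank-one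
    -- relation leaves a single one.
    · by_cases h : a = 0 ∧ b = 0
      · obtain ⟨rfl, rfl⟩ := h
        refine Or.inl ⟨c, d, k, ?_⟩
        rw [unipotent_zero, one_mul]
        simp only [← mul_assoc, weyl_mul_weyl, one_mul]
      · obtain ⟨l, c', d', a', b', e⟩ := weylElt_unip_weylElt m h
        rw [← eq_mul_inv_iff_mul_eq, inv_unip] at e
        have e' := congrArg Subtype.val e
        simp only [weylElt, unip, Subgroup.coe_mul] at e'
        change _ = _ * torus m l * _ at e'
        have e₂ : weyl * (unipotent m a b * weyl * unipotent m c d * torus m k) =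
            unipotent m a' b' * weyl * (torus m l * (unipotent m c' (d' + c' * theta m c') *
              unipotent m c d)) * torus m k := by
          simp only [← mul_assoc, e']
        rw [e₂, unipotent_mul, torus_mul_unipotent]
        exact Or.inr ⟨a', b', _, _, l * k, by simp only [mul_assoc, torus_mul]; rfl⟩

theorem eq_of_smul_infty {g : Sz F m} (h : g • (.infty : Ovoid F) = .infty) :
    ∃ a b k, g = unip m a b * tor m k := by
  rcases bruhat m g with h' | ⟨a, b, c, d, k, rfl⟩
  · exact h'
  · rw [mul_smul, mul_smul, mul_smul, tor_smul_infty, unip_smul_infty, weylElt_smul_infty,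
      unip_smul_affine] at h
    cases h

theorem eq_of_smul_infty_smul_zero {g : Sz F m} (h : g • (.infty : Ovoid F) = .infty)
    (h0 : g • (.affine 0 0 : Ovoid F) = .affine 0 0) : ∃ k, g = tor m k := by
  obtain ⟨a, b, k, rfl⟩ := eq_of_smul_infty m h
  rw [mul_smul, tor_smul_affine, unip_smul_affine] at h0
  obtain ⟨rfl, rfl⟩ : a = 0 ∧ b = 0 := by simpa using h0
  exact ⟨k, by rw [unip_zero, one_mul]⟩

end Action

/-! ### Cyclic hulls and auxiliary group theory -/

/-- All cyclic subgroups containing `z` lie in a common cyclic subgroup. -/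
def HasCyclicHull {G : Type*} [Group G] (z : G) : Prop :=
  ∃ C : Subgroup G, IsCyclic C ∧ ∀ x, z ∈ Subgroup.zpowers x → x ∈ C

theorem HasCyclicHull.of_conj {G : Type*} [Group G] (g : G) {z : G}
    (h : HasCyclicHull (g * z * g⁻¹)) : HasCyclicHull z := by
  obtain ⟨C, hC, hx⟩ := h
  refine ⟨C.map (MulAut.conj g⁻¹).toMonoidHom, ?_, fun x hz => ?_⟩
  · exact isCyclic_of_surjective _ (C.equivMapOfInjective _ (MulAut.conj g⁻¹).injective).surjective
  · obtain ⟨n, rfl⟩ := hz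
    refine ⟨g * x * g⁻¹, hx _ ⟨n, ?_⟩, ?_⟩
    · simp [conj_zpow]
    · simp [mul_assoc]

/-- Let `z = x ^ n`. An even `n` would give `z ^ 2 = 1`; for odd `n`, `n ^ 2 ≡ 1` modulo 4, so `z ^
n = x`. -/
theorem mem_zpowers_of_pow_four_eq_one {G : Type*} [Group G] {x z : G} (hx : x ^ 4 = 1)
    (hz : z ^ 2 ≠ 1) (h : z ∈ Subgroup.zpowers x) : x ∈ Subgroup.zpowers z := by
  obtain ⟨n, rfl⟩ := h
  have hx' : x ^ (4 : ℤ) = 1 := by exact_mod_cast hx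
  dsimp only at hz ⊢
  rcases Int.even_or_odd' n with ⟨j, rfl | rfl⟩
  · refine absurd ?_ hz
    rw [← zpow_natCast, ← zpow_mul, show 2 * j * ((2 : ℕ) : ℤ) = 4 * j by push_cast; ring, zpow_mul,
      hx', one_zpow]
  · refine ⟨2 * j + 1, ?_⟩
    dsimp only
    rw [← zpow_mul, show (2 * j + 1) * (2 * j + 1) = 4 * (j ^ 2 + j) + 1 by ring, zpow_add, zpow_mul,
      hx', one_zpow, one_mul, zpow_one]

theorem card_ovoid (F : Type*) [Finite F] : Nat.card (Ovoid F) = Nat.card F ^ 2 + 1 := by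
  rw [Nat.card_congr (Ovoid.equivOption F), Finite.card_option, Nat.card_prod, pow_two]

theorem commute_conj_conj {G : Type*} [Group G] {x u : G} (h : Commute x u) (g : G) :
    Commute (g * x * g⁻¹) (g * u * g⁻¹) := by
  have := h.map (MulAut.conj g)
  simpa using this

/-! ### Fixed points, centralizers and element orders -/

section FixedPoints

variable {F : Type*} [Field F] (m : ℕ) [hF : Fact (Nat.card F = 2 ^ (2 * m + 1))]

theorem eq_zero_of_unip_smul_affine {a b c d : F}
    (h : unip m a b • (.affine c d : Ovoid F) = .affine c d) : a = 0 ∧ b = 0 := by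
  rw [unip_smul_affine, Ovoid.affine.injEq] at h
  obtain rfl : a = 0 := by simpa using h.1
  exact ⟨rfl, by simpa [theta_zero] using h.2⟩

theorem eq_zero_of_tor_smul_affine {k : Fˣ} (hk : k ≠ 1) {c d : F}
    (h : tor m k • (.affine c d : Ovoid F) = .affine c d) : c = 0 ∧ d = 0 := by
  have h0 : (k : F) ≠ 0 := k.ne_zero
  have h1 : theta m (k : F) ≠ 0 := (theta_eq_zero m).not.mpr h0
  have h2 : theta m (k : F) ≠ 1 := fun e => hk (Units.ext (eq_one_of_theta_eq_one m e))
  have h3 : (k : F) ^ 2 * theta m (k : F) ≠ 1 :=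
    fun e => hk (Units.ext (eq_one_of_sq_mul_theta_eq_one m e))
  rw [tor_smul_affine, Ovoid.affine.injEq, div_eq_iff h1,
    div_eq_iff (mul_ne_zero (pow_ne_zero 2 h0) h1)] at h
  constructor
  · by_contra hc
    exact h2 (mul_left_cancel₀ hc (by rw [mul_one]; exact h.1.symm))
  · by_contra hd
    exact h3 (mul_left_cancel₀ hd (by rw [mul_one]; exact h.2.symm))

/-- Infinity is the only fixed point of a nontrivial `S(a, b)`, and commuting elements preserve the
fixed-point set. -/
theorem smul_infty_of_commute_unip {a b : F} (h : ¬(a = 0 ∧ b = 0)) {x : Sz F m}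
    (hx : Commute x (unip m a b)) : x • (.infty : Ovoid F) = .infty := by
  have e : unip m a b • x • (.infty : Ovoid F) = x • .infty := by
    rw [← mul_smul, ← hx.eq, mul_smul, unip_smul_infty]
  generalize x • (.infty : Ovoid F) = ω at e
  rcases ω with _ | ⟨c, d⟩
  · rfl
  · exact absurd (eq_zero_of_unip_smul_affine m e) h

/-- The fixed points of `tor m k` are infinity and the origin, so `x` fixes or swaps them. -/
theorem mem_range_tor_of_commute {k : Fˣ} (hk : k ≠ 1) {x : Sz F m}
    (hx : Commute x (tor m k)) : x ∈ (tor (F := F) m).range := by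
  have fix : ∀ ω : Ovoid F, tor m k • ω = ω → ω = .infty ∨ ω = .affine 0 0 := by
    rintro (_ | ⟨c, d⟩) h
    · exact Or.inl rfl
    · obtain ⟨rfl, rfl⟩ := eq_zero_of_tor_smul_affine m hk h
      exact Or.inr rfl
  have comm : ∀ ω : Ovoid F, tor m k • ω = ω → tor m k • x • ω = x • ω := fun ω h => by
    rw [← mul_smul, ← hx.eq, mul_smul, h]
  have f0 : tor m k • (.affine 0 0 : Ovoid F) = .affine 0 0 := by
    rw [tor_smul_affine, zero_div, zero_div]
  have ne : x • (.infty : Ovoid F) ≠ x • .affine 0 0 := by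
    rw [Ne, smul_left_cancel_iff]
    simp
  rcases fix _ (comm _ (tor_smul_infty m k)) with h1 | h1 <;> rcases fix _ (comm _ f0) with h2 | h2
  · exact absurd (h1.trans h2.symm) ne
  · obtain ⟨l, rfl⟩ := eq_of_smul_infty_smul_zero m h1 h2
    exact ⟨l, rfl⟩
  -- In the swapping case `weylElt m * x` lies in the torus, so `x` both inverts and centralizes
  -- `tor m k`; then `k ^ 2 = 1`, which forces `k = 1` in characteristic 2.
  · exfalso
    obtain ⟨l, hl⟩ := eq_of_smul_infty_smul_zero m (g := weylElt m * x)
      (by rw [mul_smul, h1, weylElt_smul_zero]) (by rw [mul_smul, h2, weylElt_smul_infty])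
    have e : weylElt m * x * tor m k = tor m k⁻¹ * (weylElt m * x) := by
      rw [mul_assoc, hx.eq, ← mul_assoc, weylElt_mul_tor, mul_assoc]
    rw [hl, ← map_mul, ← map_mul, mul_comm] at e
    have e' : k = k⁻¹ := mul_right_cancel (tor_injective m e)
    have : k ^ 2 = 1 := by
      rw [pow_two]
      nth_rewrite 1 [e']
      exact inv_mul_cancel k
    exact hk (Units.ext (eq_one_of_sq_eq_one m (congrArg Units.val this)))
  · exact absurd (h1.trans h2.symm) ne

theorem exists_smul_eq_infty (ω : Ovoid F) : ∃ g : Sz F m, g • ω = .infty := by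
  rcases ω with _ | ⟨a, b⟩
  · exact ⟨1, one_smul _ _⟩
  · refine ⟨(unip m a b * weylElt m)⁻¹, ?_⟩
    rw [inv_smul_eq_iff, mul_smul, weylElt_smul_infty, unip_smul_affine]
    simp

theorem exists_affine_fixed (a b : F) {k : Fˣ} (hk : k ≠ 1) :
    ∃ c d, (unip m a b * tor m k) • (.affine c d : Ovoid F) = .affine c d := by
  have h0 : (k : F) ≠ 0 := k.ne_zero
  have h1 : theta m (k : F) ≠ 0 := (theta_eq_zero m).not.mpr h0
  have h2 : theta m (k : F) - 1 ≠ 0 :=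
    sub_ne_zero.mpr fun e => hk (Units.ext (eq_one_of_theta_eq_one m e))
  have h3 : (k : F) ^ 2 * theta m (k : F) - 1 ≠ 0 :=
    sub_ne_zero.mpr fun e => hk (Units.ext (eq_one_of_sq_mul_theta_eq_one m e))
  -- The fixed-point equations are triangular: `c` solves `a + c / θ(k) = c`, and then the second
  -- coordinate solves a linear equation with `c` known.
  let c := a * theta m (k : F) / (theta m (k : F) - 1)
  refine ⟨c, (b + theta m a * (c / theta m (k : F))) * (k ^ 2 * theta m (k : F)) /
    (k ^ 2 * theta m (k : F) - 1), ?_⟩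
  rw [mul_smul, tor_smul_affine, unip_smul_affine, Ovoid.affine.injEq]
  constructor
  · simp only [c]
    field_simp
    ring
  · rw [add_right_comm]
    have h4 := mul_ne_zero (pow_ne_zero 2 h0) h1
    generalize b + theta m a * (c / theta m (k : F)) = x
    generalize (k : F) ^ 2 * theta m (k : F) = y at h3 h4
    field_simp
    ring

/-- A nontrivial element with a fixed point is conjugate to an element of the standard
unipotent subgroup or of the split torus. -/
theorem exists_conj_eq {u : Sz F m} (hu : u ≠ 1) {ω : Ovoid F} (h : u • ω = ω) :
    ∃ g : Sz F m, (∃ a b, ¬(a = 0 ∧ b = 0) ∧ g * u * g⁻¹ = unip m a b) ∨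
      ∃ k, k ≠ 1 ∧ g * u * g⁻¹ = tor m k := by
  obtain ⟨g, hg⟩ := exists_smul_eq_infty m ω
  have h' : (g * u * g⁻¹) • (.infty : Ovoid F) = .infty := by
    rw [← hg, mul_smul, mul_smul, inv_smul_smul, h]
  have hne : ∀ g : Sz F m, g * u * g⁻¹ ≠ 1 := fun g e => hu (by simpa using e)
  obtain ⟨a, b, k, e⟩ := eq_of_smul_infty m h'
  by_cases hk : k = 1
  · subst hk
    rw [map_one, mul_one] at e
    refine ⟨g, Or.inl ⟨a, b, ?_, e⟩⟩
    rintro ⟨rfl, rfl⟩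
    exact hne g (e.trans (unip_zero m))
  · obtain ⟨c, d, hf⟩ := exists_affine_fixed m a b hk
    -- `S(c, d)` fixes infinity and moves the origin to the second fixed point, so conjugating by
    -- its inverse gives an element fixing both.
    have e0 : unip m c d • (.affine 0 0 : Ovoid F) = .affine c d := by
      rw [unip_smul_affine]
      simp
    have e1 : ((unip m c d)⁻¹ * g) * u * ((unip m c d)⁻¹ * g)⁻¹ =
        (unip m c d)⁻¹ * (unip m a b * tor m k) * unip m c d := by
      rw [← e]
      group
    obtain ⟨l, hl⟩ := eq_of_smul_infty_smul_zero m
      (g := (unip m c d)⁻¹ * (unip m a b * tor m k) * unip m c d)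
      (by rw [mul_smul, mul_smul, unip_smul_infty, inv_smul_eq_iff, mul_smul, tor_smul_infty,
        unip_smul_infty, unip_smul_infty])
      (by rw [mul_smul, mul_smul, e0, hf, inv_smul_eq_iff, e0])
    refine ⟨(unip m c d)⁻¹ * g, Or.inr ⟨l, ?_, e1.trans hl⟩⟩
    rintro rfl
    rw [map_one] at hl
    exact hne _ (e1.trans hl)

/-- Applied to powers of `z`, this shows that `⟨z⟩` acts freely as soon as `z` has no fixed point.
-/
theorem exists_fixed_of_commute {u x : Sz F m} (hu : u ≠ 1) {ω : Ovoid F} (h : u • ω = ω)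
    (hx : Commute x u) : ∃ ω' : Ovoid F, x • ω' = ω' := by
  obtain ⟨g, hg⟩ := exists_conj_eq m hu h
  have hx' := commute_conj_conj hx g
  suffices (g * x * g⁻¹) • (.infty : Ovoid F) = .infty by
    refine ⟨g⁻¹ • .infty, ?_⟩
    rwa [mul_smul, mul_smul, ← eq_inv_smul_iff] at this
  rcases hg with ⟨a, b, hab, e⟩ | ⟨k, hk, e⟩ <;> rw [e] at hx'
  · exact smul_infty_of_commute_unip m hab hx'
  · obtain ⟨l, hl⟩ := mem_range_tor_of_commute m hk hx'
    rw [← hl, tor_smul_infty]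

theorem unip_zero_sq (b : F) : unip m 0 b ^ 2 = 1 := by
  have := charP_two m (F := F)
  rw [pow_two, unip_mul, mul_zero, add_zero, add_zero, CharTwo.add_self_eq_zero, unip_zero]

theorem unip_pow_four (a b : F) : unip m a b ^ 4 = 1 := by
  have := charP_two m (F := F)
  have h := pow_mul (unip m a b) 2 2
  rwa [pow_two (unip m a b), unip_mul, CharTwo.add_self_eq_zero, unip_zero_sq] at h

theorem hasCyclicHull_unip {a b : F} (h : unip m a b ^ 2 ≠ 1) :
    HasCyclicHull (unip m a b) := by
  refine ⟨Subgroup.zpowers (unip m a b), inferInstance, fun x hz => ?_⟩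
  have ha : a ≠ 0 := by
    rintro rfl
    exact h (unip_zero_sq m b)
  have hx : Commute x (unip m a b) := by
    obtain ⟨n, hn⟩ := hz
    rw [← hn]
    exact Commute.self_zpow x n
  obtain ⟨c, d, k, rfl⟩ :=
    eq_of_smul_infty m (smul_infty_of_commute_unip m (fun h => ha h.1) hx)
  -- Comparing the first coordinates of the two images of the origin gives `a / θ(k) = a`, so the
  -- torus part of the commuting element is trivial.
  have e := congrArg (· • (.affine 0 0 : Ovoid F)) hx.eq
  simp only [mul_smul, unip_smul_affine, tor_smul_affine, Ovoid.affine.injEq] at e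
  have h0 : theta m (k : F) ≠ 0 := (theta_eq_zero m).not.mpr k.ne_zero
  have e1 : a / theta m (k : F) = a := by
    have := e.1
    simp only [add_zero, zero_div] at this
    rwa [add_comm a, add_right_inj] at this
  obtain rfl : k = 1 := Units.ext (eq_one_of_theta_eq_one m (by
    rw [div_eq_iff h0] at e1
    exact mul_left_cancel₀ ha (by rw [mul_one]; exact e1.symm)))
  rw [map_one, mul_one] at hz ⊢
  exact mem_zpowers_of_pow_four_eq_one (unip_pow_four m c d) h hz

theorem hasCyclicHull_tor {k : Fˣ} (hk : k ≠ 1) : HasCyclicHull (tor m k) := by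
  have := finite_of_card m (F := F)
  refine ⟨(tor m).range, isCyclic_of_surjective _ (tor m).rangeRestrict_surjective, ?_⟩
  rintro x ⟨n, hn⟩
  apply mem_range_tor_of_commute m hk
  rw [← hn]
  exact Commute.self_zpow x n

theorem hasCyclicHull_of_fixed {z : Sz F m} (hz : z ^ 2 ≠ 1) {ω : Ovoid F} (h : z • ω = ω) :
    HasCyclicHull z := by
  have h1 : z ≠ 1 := by
    rintro rfl
    exact hz (one_pow 2)
  obtain ⟨g, ⟨a, b, -, e⟩ | ⟨k, hk, e⟩⟩ := exists_conj_eq m h1 h <;>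
    refine .of_conj g ?_ <;> rw [e]
  · apply hasCyclicHull_unip
    rw [← e, conj_pow]
    intro h
    exact hz (by simpa using h)
  · exact hasCyclicHull_tor m hk

/-- The order of an element without fixed points. -/
theorem orderOf_dvd_of_no_fixed {z : Sz F m} (h : ∀ ω : Ovoid F, z • ω ≠ ω) :
    orderOf z ∣ Nat.card F ^ 2 + 1 := by
  have := finite_of_card m (F := F)
  have := Finite.of_equiv _ (Ovoid.equivOption F).symm
  have free : ∀ u : Subgroup.zpowers z, u ≠ 1 → IsEmpty (MulAction.fixedBy (Ovoid F) u) := by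
    rintro ⟨u, n, rfl⟩ hu
    refine ⟨fun ⟨ω, hω⟩ => ?_⟩
    obtain ⟨ω', h'⟩ := exists_fixed_of_commute m (fun e => hu (Subtype.ext e)) hω
      (Commute.self_zpow z n)
    exact h ω' h'
  -- By freeness only the identity contributes to Burnside's count, so the number of points is the
  -- number of orbits times the order of `z`.
  have e : (Σ u : Subgroup.zpowers z, MulAction.fixedBy (Ovoid F) u) ≃ Ovoid F :=
    { toFun := fun p => p.2
      invFun := fun ω => ⟨1, ω, one_smul _ ω⟩
      left_inv := by
        rintro ⟨u, ω⟩
        by_cases hu : u = 1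
        · subst hu
          rfl
        · exact ((free u hu).false ω).elim
      right_inv := fun ω => rfl }
  have := Nat.card_congr (e.symm.trans
    (MulAction.sigmaFixedByEquivOrbitsProdGroup (Subgroup.zpowers z) (Ovoid F)))
  rw [card_ovoid, Nat.card_prod, Nat.card_zpowers] at this
  exact Dvd.intro_left _ this.symm

end FixedPoints

/-! ### Irreducibility of elements of order dividing `q ^ 2 + 1` -/

section Irreducible

variable {F : Type*} [Field F]

/-- In each case an integer combination of the two numbers equals 2, while `q ^ 2 + 1` is odd. -/
theorem coprime_sq_add_one_pow_sub_one {q j : ℕ} (hq : Even q) (hj : j = 1 ∨ j = 2 ∨ j = 3) :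
    Nat.Coprime (q ^ 2 + 1) (q ^ j - 1) := by
  refine Nat.Coprime.symm (Nat.coprime_of_dvd' ?_)
  intro p hp h1 h2
  exfalso
  have h2' : (p : ℤ) ∣ (q : ℤ) ^ 2 + 1 := by exact_mod_cast h2
  have h1' : (p : ℤ) ∣ (q : ℤ) ^ j - 1 := by
    rcases Nat.eq_zero_or_pos (q ^ j) with h0 | h0
    · have : q = 0 := by
        rcases hj with rfl | rfl | rfl <;> simpa using h0
      subst this
      exact absurd h2 (by simpa using hp.one_lt.ne')
    · have := Int.natCast_dvd_natCast.mpr h1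
      rwa [Nat.cast_sub h0, Nat.cast_pow, Nat.cast_one] at this
  have h : (p : ℤ) ∣ 2 := by
    rcases hj with rfl | rfl | rfl
    · have := dvd_sub h2' (h1'.mul_left ((q : ℤ) + 1))
      ring_nf at this
      exact this
    · have := dvd_sub h2' h1'
      ring_nf at this
      exact this
    · have := dvd_add h2' ((dvd_sub h1' (h2'.mul_left (q : ℤ))).mul_left ((q : ℤ) - 1))
      ring_nf at this
      exact this
  have h' : p ∣ 2 := by exact_mod_cast h
  obtain rfl := (Nat.prime_dvd_prime_iff_eq hp Nat.prime_two).mp h'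
  have : ¬ 2 ∣ q ^ 2 + 1 := by
    rw [← even_iff_two_dvd, Nat.not_even_iff_odd]
    exact (hq.pow_of_ne_zero two_ne_zero).add_one
  exact this h2

theorem coprime_card_GL [Finite F] (hq : Even (Nat.card F)) {n : ℕ} (hn : n ≤ 3) :
    Nat.Coprime (Nat.card F ^ 2 + 1) (Nat.card (GL (Fin n) F)) := by
  have := Fintype.ofFinite F
  rw [Matrix.card_GL_field, ← Nat.card_eq_fintype_card]
  refine Nat.Coprime.prod_right fun i _ => ?_
  have hi := i.2
  rw [show Nat.card F ^ n - Nat.card F ^ (i : ℕ) =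
    Nat.card F ^ (i : ℕ) * (Nat.card F ^ (n - i) - 1) by
      rw [Nat.mul_sub, ← pow_add, mul_one, Nat.add_sub_cancel' hi.le]]
  refine Nat.Coprime.mul_right (Nat.Coprime.pow_right _ ?_)
    (coprime_sq_add_one_pow_sub_one hq (by omega))
  rw [pow_two, Nat.coprime_mul_left_add_left]
  exact Nat.coprime_one_left _

theorem eq_one_of_pow_eq_one_of_finrank_le [Finite F] (hq : Even (Nat.card F))
    {W : Type*} [AddCommGroup W] [Module F W] [FiniteDimensional F W]
    (hW : Module.finrank F W ≤ 3) {g : Module.End F W} (hg : g ^ (Nat.card F ^ 2 + 1) = 1) :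
    g = 1 := by
  have := Fintype.ofFinite F
  let e := LinearMap.toMatrixAlgEquiv (Module.finBasis F W)
  let u : (Module.End F W)ˣ := Units.ofPowEqOne g _ hg (Nat.succ_ne_zero _)
  let U : GL (Fin (Module.finrank F W)) F := Units.map e.toAlgHom.toRingHom.toMonoidHom u
  have h1 : U ^ (Nat.card F ^ 2 + 1) = 1 := by
    rw [← map_pow, Units.pow_ofPowEqOne, map_one]
  have h2 : U ^ Nat.card (GL (Fin (Module.finrank F W)) F) = 1 := pow_card_eq_one'
  have hU : U = 1 := by
    rw [← orderOf_eq_one_iff]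
    exact Nat.eq_one_of_dvd_coprimes (coprime_card_GL hq hW) (orderOf_dvd_of_pow_eq_one h1)
      (orderOf_dvd_of_pow_eq_one h2)
  have : e g = 1 := congrArg Units.val hU
  exact e.injective (this.trans (map_one e).symm)

/-- On a proper nonzero invariant `W` and on `V / W`, both of dimension at most 3, `f` is trivial by
coprimality. So `f - 1` maps `V` into `W` and kills `W`; in characteristic 2 this gives `f ^ 2 = 1`,
and `q ^ 2 + 1` is odd. -/
theorem eq_bot_or_eq_top_of_invariant [Finite F] [CharP F 2]
    {V : Type*} [AddCommGroup V] [Module F V] (hV : Module.finrank F V = 4)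
    {f : Module.End F V} (hf : f ^ (Nat.card F ^ 2 + 1) = 1) (hf1 : f ≠ 1)
    (W : Submodule F V) (hW : ∀ v ∈ W, f v ∈ W) : W = ⊥ ∨ W = ⊤ := by
  have : FiniteDimensional F V := FiniteDimensional.of_finrank_pos (by omega)
  have := Fintype.ofFinite F
  have hq : Even (Nat.card F) := by
    rw [Nat.card_eq_fintype_card]
    exact Nat.even_iff.mpr (FiniteField.even_card_of_char_two (ringChar.eq F 2))
  by_contra! hne
  have hlt := Submodule.finrank_lt hne.2
  have hpos : 0 < Module.finrank F W := by
    rw [Nat.pos_iff_ne_zero, Ne, Submodule.finrank_eq_zero]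
    exact hne.1
  have hsum := Submodule.finrank_quotient_add_finrank W
  have h1 : f.restrict hW = 1 := by
    apply eq_one_of_pow_eq_one_of_finrank_le hq (by omega)
    rw [Module.End.pow_restrict _ hW]
    ext v
    exact LinearMap.congr_fun hf v
  have h2 : W.mapQ W f hW = 1 := by
    apply eq_one_of_pow_eq_one_of_finrank_le hq (by omega)
    rw [← Submodule.mapQ_pow]
    ext v
    exact congrArg (Submodule.Quotient.mk (p := W)) (LinearMap.congr_fun hf v)
  have h3 : ∀ v ∈ W, f v = v := fun v hv => by
    simpa using congrArg Subtype.val (LinearMap.congr_fun h1 ⟨v, hv⟩)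
  have h4 : ∀ v, f v - v ∈ W := fun v => by
    rw [← Submodule.Quotient.eq]
    exact LinearMap.congr_fun h2 (Submodule.Quotient.mk v)
  have h5 : f ^ 2 = 1 := by
    ext v
    have := h3 _ (h4 v)
    rw [map_sub] at this
    have h6 : f v - v + (f v - v) = 0 := by
      rw [← two_smul F, CharTwo.two_eq_zero, zero_smul]
    rw [pow_two, Module.End.mul_apply, Module.End.one_apply]
    rw [← sub_eq_zero, ← h6]
    nth_rewrite 1 [← this]
    abel
  have h6 : f ^ (Nat.card F ^ 2) = 1 := by
    obtain ⟨s, hs⟩ := (hq.pow_of_ne_zero two_ne_zero).two_dvd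
    rw [hs, pow_mul, h5, one_pow]
  rw [pow_succ, h6, one_mul] at hf
  exact hf1 hf

/-- The centralizer of an irreducible element is cyclic, by the lemma of Schur and the theorem of
Wedderburn. -/
theorem isCyclic_centralizer_of_irreducible [Finite F]
    {V : Type*} [AddCommGroup V] [Module F V] [FiniteDimensional F V] [Nontrivial V]
    {f : Module.End F V}
    (hf : ∀ W : Submodule F V, (∀ v ∈ W, f v ∈ W) → W = ⊥ ∨ W = ⊤)
    {G : Type*} [Group G] [Finite G] (φ : G →* Module.End F V) (hφ : Function.Injective φ)
    (hc : ∀ g, Commute (φ g) f) : IsCyclic G := by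
  let D := Subring.centralizer ({f} : Set (Module.End F V))
  have : Finite (Module.End F V) := Module.finite_of_finite F
  have comm : ∀ A : D, ∀ v, f (A.1 v) = A.1 (f v) := fun A v =>
    LinearMap.congr_fun (Subring.mem_centralizer_iff.mp A.2 f rfl) v
  -- Schur: the kernel of an endomorphism commuting with `f` is invariant under `f`.
  have : NoZeroDivisors D := by
    refine ⟨fun {A B} h => ?_⟩
    rcases hf (LinearMap.ker A.1) (fun v hv => by
      rw [LinearMap.mem_ker] at hv ⊢
      rw [← comm, hv, map_zero]) with h' | h'
    · right
      apply Subtype.ext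
      ext v
      have : B.1 v ∈ LinearMap.ker A.1 := LinearMap.congr_fun (congrArg Subtype.val h) v
      rw [h', Submodule.mem_bot] at this
      exact this
    · left
      exact Subtype.ext (LinearMap.ker_eq_top.mp h')
  have : IsDomain D := NoZeroDivisors.to_isDomain D
  let _ : CommRing D := { (inferInstance : Ring D) with
    mul_comm := (Finite.isDomain_to_isField D).mul_comm }
  let ψ : G →* D :=
    { toFun := fun g => ⟨φ g, Subring.mem_centralizer_iff.mpr (by
        rintro _ rfl
        exact (hc g).eq.symm)⟩
      map_one' := Subtype.ext (map_one φ)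
      map_mul' := fun a b => Subtype.ext (map_mul φ a b) }
  exact isCyclic_of_injective_ringHom (f := ψ) fun a b h => hφ (congrArg Subtype.val h)

end Irreducible

/-! ### From cyclic hulls to the two claims -/

section Conclusion

theorem hasCyclicHull_of_sq_ne_one {F : Type*} [Field F] (m : ℕ)
    [hF : Fact (Nat.card F = 2 ^ (2 * m + 1))] {z : Sz F m} (hz : z ^ 2 ≠ 1) :
    HasCyclicHull z := by
  have := finite_of_card m (F := F)
  have := charP_two m (F := F)
  have : Finite SL(4, F) := Subtype.finite
  by_cases h : ∃ ω : Ovoid F, z • ω = ω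
  · obtain ⟨ω, h⟩ := h
    exact hasCyclicHull_of_fixed m hz h
  push Not at h
  have hord := orderOf_dvd_iff_pow_eq_one.mp (orderOf_dvd_of_no_fixed m h)
  let ρ : Sz F m →* Module.End F (Fin 4 → F) :=
    { toFun := fun g => Matrix.toLinAlgEquiv' (g : SL(4, F)).1
      map_one' := map_one Matrix.toLinAlgEquiv'
      map_mul' := fun g h => map_mul Matrix.toLinAlgEquiv' (g : SL(4, F)).1 (h : SL(4, F)).1 }
  have hρ : Function.Injective ρ := fun g h e =>
    Subtype.ext (Subtype.ext (Matrix.toLinAlgEquiv'.injective e))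
  have hz1 : z ≠ 1 := by
    rintro rfl
    exact hz (one_pow 2)
  -- Any `x` having `z` as a power commutes with `z`, so a cyclic centralizer is a hull.
  refine ⟨Subgroup.centralizer {z}, ?_, ?_⟩
  · refine isCyclic_centralizer_of_irreducible (f := ρ z)
      (eq_bot_or_eq_top_of_invariant (Module.finrank_fin_fun F) (by rw [← map_pow, hord, map_one])
        fun e => hz1 (hρ (e.trans (map_one ρ).symm)))
      (ρ.comp (Subgroup.subtype _)) (hρ.comp Subtype.val_injective) ?_
    intro g
    have : Commute (g : Sz F m) z := (Subgroup.mem_centralizer_singleton_iff.mp g.2)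
    exact this.map ρ
  · rintro x ⟨n, rfl⟩
    exact Subgroup.mem_centralizer_singleton_iff.mpr (Commute.self_zpow x n)

variable {G : Type*} [Group G]

theorem isCyclic_closure_pair_of_mem {C : Subgroup G} [IsCyclic C] {x y : G} (hx : x ∈ C)
    (hy : y ∈ C) : IsCyclic (Subgroup.closure ({x, y} : Set G)) := by
  have h : Subgroup.closure ({x, y} : Set G) ≤ C := by
    rw [Subgroup.closure_le]
    rintro _ (rfl | rfl) <;> assumption
  exact isCyclic_of_injective (Subgroup.inclusion h) (Subgroup.inclusion_injective h)

theorem exists_zpowers_of_isCyclic {H : Subgroup G} (h : IsCyclic H) :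
    ∃ g, H = Subgroup.zpowers g := by
  obtain ⟨g, hg⟩ := H.isCyclic_iff_exists_zpowers_eq_top.mp h
  exact ⟨g, hg.symm⟩

theorem mem_of_adj {z x : G} {C : Subgroup G} (hC : ∀ x, z ∈ Subgroup.zpowers x → x ∈ C)
    (h : (enhancedPowerGraph G).Adj z x) : x ∈ C := by
  obtain ⟨g, hg⟩ := exists_zpowers_of_isCyclic h.2
  have hz : z ∈ Subgroup.zpowers g := hg ▸ Subgroup.subset_closure (Set.mem_insert _ _)
  have hx : x ∈ Subgroup.zpowers g :=
    hg ▸ Subgroup.subset_closure (Set.mem_insert_of_mem _ rfl)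
  exact Subgroup.zpowers_le_of_mem (hC g hz) hx

theorem HasCyclicHull.adj {z x y : G} (hz : HasCyclicHull z)
    (hx : (enhancedPowerGraph G).Adj z x) (hy : (enhancedPowerGraph G).Adj z y) (hxy : x ≠ y) :
    (enhancedPowerGraph G).Adj x y := by
  obtain ⟨C, hC, h⟩ := hz
  exact ⟨hxy, isCyclic_closure_pair_of_mem (mem_of_adj h hx) (mem_of_adj h hy)⟩

theorem adj_one {x : G} (hx : x ≠ 1) : (enhancedPowerGraph G).Adj 1 x :=
  ⟨hx.symm, isCyclic_closure_pair_of_mem (C := Subgroup.zpowers x) (one_mem _)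
    (Subgroup.mem_zpowers x)⟩

theorem eq_of_sq_eq_one_of_isCyclic [Finite G] [IsCyclic G] {x y : G} (hx : x ^ 2 = 1)
    (hy : y ^ 2 = 1) (hx1 : x ≠ 1) (hy1 : y ≠ 1) : x = y := by
  classical
  have := Fintype.ofFinite G
  by_contra hxy
  have h := IsCyclic.card_pow_eq_one_le (α := G) two_pos
  have h3 : ({1, x, y} : Finset G).card = 3 := Finset.card_eq_three.mpr
    ⟨1, x, y, hx1.symm, hy1.symm, hxy, rfl⟩
  have : ({1, x, y} : Finset G) ⊆ Finset.univ.filter fun a => a ^ 2 = 1 := by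
    intro a ha
    simp only [Finset.mem_insert, Finset.mem_singleton] at ha
    rcases ha with rfl | rfl | rfl <;> simp [hx, hy]
  have := Finset.card_le_card this
  omega

theorem isCograph_of_hasCyclicHull [Finite G] (hG : ∀ z : G, z ^ 2 ≠ 1 → HasCyclicHull z) :
    IsCograph (enhancedPowerGraph G) := by
  rintro ⟨f⟩
  have adj : ∀ i j : Fin 4, (SimpleGraph.pathGraph 4).Adj i j →
      (enhancedPowerGraph G).Adj (f i) (f j) := fun i j h => f.map_rel_iff.mpr h
  have nadj : ∀ i j : Fin 4, ¬(SimpleGraph.pathGraph 4).Adj i j →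
      ¬(enhancedPowerGraph G).Adj (f i) (f j) := fun i j h h' => h (f.map_rel_iff.mp h')
  have h01 := adj 0 1 (by simp [SimpleGraph.pathGraph_adj])
  have h12 := adj 1 2 (by simp [SimpleGraph.pathGraph_adj])
  have h23 := adj 2 3 (by simp [SimpleGraph.pathGraph_adj])
  have h02 := nadj 0 2 (by simp [SimpleGraph.pathGraph_adj])
  have h13 := nadj 1 3 (by simp [SimpleGraph.pathGraph_adj])
  have n02 : f 0 ≠ f 2 := f.injective.ne (by decide)
  have n13 : f 1 ≠ f 3 := f.injective.ne (by decide)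
  have s1 : f 1 ^ 2 = 1 := by
    by_contra h
    exact h02 ((hG _ h).adj h01.symm h12 n02)
  have s2 : f 2 ^ 2 = 1 := by
    by_contra h
    exact h13 ((hG _ h).adj h12.symm h23 n13)
  have t1 : f 1 ≠ 1 := fun h => h13 (h ▸ adj_one (h ▸ n13.symm))
  have t2 : f 2 ≠ 1 := fun h => h02 (h ▸ (adj_one (h ▸ n02)).symm)
  have := h12.2
  have e := eq_of_sq_eq_one_of_isCyclic
    (x := (⟨f 1, Subgroup.subset_closure (Set.mem_insert _ _)⟩ :
      Subgroup.closure ({f 1, f 2} : Set G)))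
    (y := ⟨f 2, Subgroup.subset_closure (Set.mem_insert_of_mem _ rfl)⟩)
    (Subtype.ext s1) (Subtype.ext s2) (fun h => t1 (congrArg Subtype.val h))
    (fun h => t2 (congrArg Subtype.val h))
  exact h12.1 (congrArg Subtype.val e)

theorem card_inf_le_two_of_hasCyclicHull [Finite G]
    (hG : ∀ z : G, z ^ 2 ≠ 1 → HasCyclicHull z) {C D : Subgroup G} (hC : IsMaximalCyclic C)
    (hD : IsMaximalCyclic D) (hCD : C ≠ D) : Nat.card (C ⊓ D : Subgroup G) ≤ 2 := by
  have : IsCyclic C := hC.prop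
  obtain ⟨x, hx⟩ := exists_zpowers_of_isCyclic hC.prop
  obtain ⟨y, hy⟩ := exists_zpowers_of_isCyclic hD.prop
  obtain ⟨z, hz⟩ := exists_zpowers_of_isCyclic (H := C ⊓ D)
    (isCyclic_of_injective (Subgroup.inclusion inf_le_left)
      (Subgroup.inclusion_injective inf_le_left))
  have hzCD : z ∈ C ⊓ D := hz ▸ Subgroup.mem_zpowers z
  rw [hz, Nat.card_zpowers]
  refine orderOf_le_of_pow_eq_one two_pos ?_
  by_contra h
  obtain ⟨K, hK, hK'⟩ := hG z h
  have hCK : C ≤ K := hx ▸ Subgroup.zpowers_le_of_mem (hK' x (hx ▸ hzCD.1))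
  have hDK : D ≤ K := hy ▸ Subgroup.zpowers_le_of_mem (hK' y (hy ▸ hzCD.2))
  exact hCD ((hC.eq_of_le hK hCK).trans (hD.eq_of_le hK hDK).symm)

end Conclusion

end Suzuki

theorem lemmal (m : ℕ) (hm : 1 ≤ m) (F : Type*) [Field F]
    (hF : Nat.card F = 2 ^ (2 * m + 1)) :
    Suzuki.IsCograph (Suzuki.enhancedPowerGraph (Suzuki.Sz F m)) ∧
      ∀ C D : Subgroup (Suzuki.Sz F m),
        Suzuki.IsMaximalCyclic C → Suzuki.IsMaximalCyclic D → C ≠ D →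
          Nat.card (C ⊓ D : Subgroup (Suzuki.Sz F m)) ≤ 2 := by
  have : Fact (Nat.card F = 2 ^ (2 * m + 1)) := ⟨hF⟩
  have := Suzuki.finite_of_card m (F := F)
  have : Finite SL(4, F) := Subtype.finite
  have h : ∀ z : Suzuki.Sz F m, z ^ 2 ≠ 1 → Suzuki.HasCyclicHull z :=
    fun z hz => Suzuki.hasCyclicHull_of_sq_ne_one m hz
  exact ⟨Suzuki.isCograph_of_hasCyclicHull h,
    fun C D hC hD hCD => Suzuki.card_inf_le_two_of_hasCyclicHull h hC hD hCD⟩
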